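/- Let $m_0,m\ge 1$ and consider a continuous-time level-dependent quasi-birth-and-death (QBD) process with states $(k,i)$, where $k\ge 0$ is the level and the phase $i$ takes $m_0$ values if $k=0$ and $m$ values if $k\ge1$, whose (conservative) infinitesimal generator is the block tridiagonal matrix $$Q=\begin{pmatrix}A_1^{(0)}&A_0^{(0)}&&&\\ A_2^{(1)}&A_1^{(1)}&A_0^{(1)}&&\\ &A_2^{(2)}&A_1^{(2)}&A_0^{(2)}&\\ &&\ddots&\ddots&\ddots\end{pmatrix},$$ the size of $A_1^{(0)}$ being $m_0$ and the size of $A_1^{(k)}$ being $m$ for $k\ge 1$. Suppose that the process is irreducible and positive recurrent. Then: (i) There is a unique stationary probability vector $x=(x_0,x_1,x_2,\dots)$, that is, $x\ge 0$, $\sum_k x_ke=1$ and $xQ=0$, where $e$ denotes a column vector of ones. (ii) The system $A_0^{(l)}+R_lA_1^{(l+1)}+R_lR_{l+1}A_2^{(l+2)}=0$, $l\ge 0$, has a unique minimal nonnegative solution $\{R_l,\ l\ge0\}$, that is, a nonnegative solution which is entrywise at most every other nonnegative solution. (iii) The matrix $U_0=A_1^{(0)}+R_0A_2^{(1)}$ is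 the generator of the chain censored to level $0$ (the process observed only while it is in level $0$), and it has a unique stationary probability vector $v$ (that is, $v\ge0$, $ve=1$, $vU_0=0$). (iv) For every $k\ge0$ the series $\sum_{l\ge0}R_kR_{k+1}\cdots R_{k+l}$ converges, and, with $$\kappa=\frac{1}{1+v\left(\sum_{k=0}^\infty R_0R_1\cdots R_k\right)e},$$ one has $x_0=\kappa v$ and $x_k=\kappa vR_0R_1\cdots R_{k-1}$ for $k\ge1$. Consequently the tail vectors $\pi_k=\sum_{j=k}^\infty x_j$ are $$\pi_k=\kappa vR_0R_1\cdots R_{k-1}\Bigl(I+\sum_{l=0}^\infty R_kR_{k+1}\cdots R_{k+l}\Bigr),\qquad k\ge1 .$$ -/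

import Mathlib

open scoped ENNReal Matrix

noncomputable section

/-! ### Continuous-time Markov chains on a discrete state space, through the generator -/

section MarkovChain

variable {S : Type*}

/-- `Q` is a (stable, conservative) infinitesimal generator: the off-diagonal entries are
nonnegative and every row sums to zero. -/
def IsGenerator (Q : Matrix S S ℝ) : Prop :=
  (∀ i j, i ≠ j → 0 ≤ Q i j) ∧ ∀ i, HasSum (fun j => Q i j) 0

/-- Every state can be reached from every state by transitions of positive rate. -/
def IsIrreducibleGenerator (Q : Matrix S S ℝ) : Prop :=
  ∀ i j, Relation.ReflTransGen (fun a b => a ≠ b ∧ 0 < Q a b) i j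

open Classical in
/-- Transition probabilities of the embedded jump chain `Y` of the generator `Q`. -/
def jumpProb (Q : Matrix S S ℝ) (i j : S) : ℝ≥0∞ :=
  if Q i i = 0 then (if i = j then 1 else 0)
  else (if i = j then 0 else ENNReal.ofReal (Q i j / (-Q i i)))

open Classical in
/-- Taboo probabilities of the chain `Y` with transition probabilities `P`:
`tabooProb P H n i j = ℙ_i (Y_n = j and Y_1, …, Y_n ∉ H)`. -/
def tabooProb (P : S → S → ℝ≥0∞) (H : Set S) : ℕ → S → S → ℝ≥0∞
  | 0, i, j => if i = j then 1 else 0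
  | n + 1, i, j => if j ∈ H then 0 else ∑' k, tabooProb P H n i k * P k j

/-- For `j ∈ H`: the probability, starting at `i`, that `Y` visits `H` at some time `n ≥ 1` and
that its first such visit is at the state `j`. -/
def entranceProb (P : S → S → ℝ≥0∞) (H : Set S) (i j : S) : ℝ≥0∞ :=
  ∑' n, ∑' k, tabooProb P H n i k * P k j

/-- The probability that the chain with generator `Q`, started at `i`, returns to `i`. -/
def returnProb (Q : Matrix S S ℝ) (i : S) : ℝ≥0∞ :=
  entranceProb (jumpProb Q) {i} i i

/-- The mean time that the chain with generator `Q`, started at `i`, spends before the jump by which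
it first returns to `i`: a visit to `j` lasts for an exponential time of mean `1 / (-Q j j)`, so
this is `∑_n ∑_j ℙ_i (Y_n = j, no return up to step n) / (-Q j j)`. It is the mean return
time to `i` when the return is almost sure. -/
def meanReturnTime (Q : Matrix S S ℝ) (i : S) : ℝ≥0∞ :=
  ∑' n, ∑' j, tabooProb (jumpProb Q) {i} n i j * (ENNReal.ofReal (-Q j j))⁻¹

/-- Positive recurrence: every state is absorbing, or is returned to almost surely and in finite
mean time. -/
def IsPositiveRecurrent (Q : Matrix S S ℝ) : Prop :=
  ∀ i, Q i i = 0 ∨ (returnProb Q i = 1 ∧ meanReturnTime Q i < ∞)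

/-- `x` is a stationary probability vector of `Q`: `x ≥ 0`, `x e = 1` and `x Q = 0`. -/
def IsStationaryVector (Q : Matrix S S ℝ) (x : S → ℝ) : Prop :=
  (∀ i, 0 ≤ x i) ∧ HasSum x 1 ∧ ∀ j, HasSum (fun i => x i * Q i j) 0

open Classical in
/-- For `i, j ∈ E`: the `(i, j)` entry of the generator of the chain censored to `E` (the chain
observed only while it is in `E`): the direct rate, plus the rate of leaving `E` from `i`
by an excursion that ends with a return to `E` at `j`. -/
def censoredGenerator (Q : Matrix S S ℝ) (E : Set S) (i j : S) : ℝ :=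
  Q i j + (∑' a, if a ∈ E then 0
    else ENNReal.ofReal (Q i a) * entranceProb (jumpProb Q) E a j).toReal

end MarkovChain

/-! ### Level-dependent QBD processes -/

/-- The number of phases of a level: `m₀` in level `0`, and `m` in the levels `k ≥ 1`. -/
@[reducible] def levelSize (m₀ m : ℕ) : ℕ → ℕ
  | 0 => m₀
  | _ + 1 => m

/-- The states: pairs of a level and a phase. -/
abbrev QBDState (m₀ m : ℕ) : Type := Σ k : ℕ, Fin (levelSize m₀ m k)

/-- The blocks of the block tridiagonal matrix of a level-dependent QBD process. Here `A0 k` is the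
block `A_0^{(k)}`, `A1 k` is `A_1^{(k)}`, while `A2 k` is `A_2^{(k+1)}` (there is no
`A_2^{(0)}`). -/
structure LevelDependentQBD (m₀ m : ℕ) where
  /-- `A0 k = A_0^{(k)}`: from level `k` to level `k + 1`. -/
  A0 : ∀ k, Matrix (Fin (levelSize m₀ m k)) (Fin (levelSize m₀ m (k + 1))) ℝ
  /-- `A1 k = A_1^{(k)}`: within level `k`. -/
  A1 : ∀ k, Matrix (Fin (levelSize m₀ m k)) (Fin (levelSize m₀ m k)) ℝ
  /-- `A2 k = A_2^{(k+1)}`: from level `k + 1` to level `k`. -/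
  A2 : ∀ k, Matrix (Fin (levelSize m₀ m (k + 1))) (Fin (levelSize m₀ m k)) ℝ

/-- A sequence of matrices `R l`, `l ≥ 0`, of the shapes of the blocks `A_0^{(l)}`. -/
abbrev RSequence (m₀ m : ℕ) : Type :=
  ∀ l : ℕ, Matrix (Fin (levelSize m₀ m l)) (Fin (levelSize m₀ m (l + 1))) ℝ

/-- `rProd R k l = R_k R_{k+1} ⋯ R_{k+l}`. -/
def rProd {m₀ m : ℕ} (R : RSequence m₀ m) (k : ℕ) :
    ℕ → Matrix (Fin (levelSize m₀ m k)) (Fin m) ℝ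
  | 0 => R k
  | l + 1 => rProd R k l * (R (k + l + 1) : Matrix (Fin m) (Fin m) ℝ)

/-- `rSeries R k = ∑_{l ≥ 0} R_k R_{k+1} ⋯ R_{k+l}`. -/
def rSeries {m₀ m : ℕ} (R : RSequence m₀ m) (k : ℕ) :
    Matrix (Fin (levelSize m₀ m k)) (Fin m) ℝ :=
  ∑' l, rProd R k l

/-- `κ = 1 / (1 + v (∑_{k ≥ 0} R_0 R_1 ⋯ R_k) e)`. -/
def kappa {m₀ m : ℕ} (R : RSequence m₀ m) (v : Fin (levelSize m₀ m 0) → ℝ) : ℝ :=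
  1 / (1 + ∑ j, (v ᵥ* rSeries R 0) j)

namespace LevelDependentQBD

variable {m₀ m : ℕ} (A : LevelDependentQBD m₀ m)

/-- The block tridiagonal matrix `Q` with the given blocks. -/
def Q : Matrix (QBDState m₀ m) (QBDState m₀ m) ℝ := fun s t =>
  if h : t.1 = s.1 then A.A1 s.1 s.2 (Fin.cast (by rw [h]) t.2)
  else if h : t.1 = s.1 + 1 then A.A0 s.1 s.2 (Fin.cast (by rw [h]) t.2)
  else if h : s.1 = t.1 + 1 then A.A2 t.1 (Fin.cast (by rw [h]) s.2) t.2
  else 0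

/-- `R` is a nonnegative solution of
`A_0^{(l)} + R_l A_1^{(l+1)} + R_l R_{l+1} A_2^{(l+2)} = 0`, `l ≥ 0`. -/
def IsNonnegSolution (R : RSequence m₀ m) : Prop :=
  (∀ l i j, 0 ≤ R l i j) ∧
    ∀ l, A.A0 l + R l * A.A1 (l + 1) + R l * R (l + 1) * A.A2 (l + 1) = 0

/-- `R` is the minimal nonnegative solution: it is entrywise below every nonnegative solution. -/
def IsMinimalNonnegSolution (R : RSequence m₀ m) : Prop :=
  A.IsNonnegSolution R ∧ ∀ R', A.IsNonnegSolution R' → ∀ l i j, R l i j ≤ R' l i j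

/-- `U_0 = A_1^{(0)} + R_0 A_2^{(1)}`. -/
def U0 (R : RSequence m₀ m) :
    Matrix (Fin (levelSize m₀ m 0)) (Fin (levelSize m₀ m 0)) ℝ :=
  A.A1 0 + R 0 * A.A2 0

end LevelDependentQBD

end

/-!
For a set `H` of states let `T_H(i, s)` be the expected time spent in `s` between two visits to `H`,
per unit of time spent in `i ∈ H`. A measure `x` with `xQ ≤ 0` outside `H` dominates its balayage
`s ↦ ∑_{i ∈ H} x_i T_H(i, s)`. If the chain is irreducible and recurrent, then such an `x` with
`xQ ≤ 0` everywhere is invariant, unique up to a factor, and equal to its balayage on `H`.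

Take for `H` the levels up to `l`. They are left only from level `l`, so the balayage of `x` has the
part `x_l R_l` on level `l + 1`, where `R_l` is the block of `T_H` between the levels `l` and
`l + 1`; hence `x_{l+1} = x_l R_l` for invariant `x`. The rows of `T_H` are themselves balayages on
the levels up to `k ≥ l`, so `T_H` has the blocks `I, R_l, R_l R_{l+1}, …` on the levels
`l, l + 1, l + 2, …`, and the balance of flow in level `l + 1` is the equation for the `R_l`. For
another nonnegative solution `R'` the measures with these products of the `R'_k` as blocks also
satisfy the balance equations outside `H`, so they dominate `T_H`: this is minimality.

On `H` the matrix `T_H Q` is the generator of the chain censored to `H`, which is `U_0` when `H` is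
level `0`. If `v U_0 = 0`, then `v, v R_0, v R_0 R_1, …` is invariant, hence a multiple of `x`, and
the factor is found by comparing total masses.
-/

section TabooGreen

variable {S : Type*} {P : S → S → ℝ≥0∞} {H H' : Set S} {i j : S}

/-- The Green function of the chain `P` killed on entering `H`: the expected number of visits to
`j` before the first visit to `H` at a time `n ≥ 1`. Time `0` counts, also when `i ∈ H`. -/
noncomputable def tabooGreen (P : S → S → ℝ≥0∞) (H : Set S) (i j : S) : ℝ≥0∞ :=
  ∑' n, tabooProb P H n i j

theorem tabooProb_zero_self : tabooProb P H 0 i i = 1 := by simp [tabooProb]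

theorem tabooProb_zero_of_ne (hij : i ≠ j) : tabooProb P H 0 i j = 0 := by simp [tabooProb, hij]

theorem tabooProb_succ_of_mem (hj : j ∈ H) (n : ℕ) : tabooProb P H (n + 1) i j = 0 := by
  simp [tabooProb, hj]

theorem tabooProb_succ_of_notMem (hj : j ∉ H) (n : ℕ) :
    tabooProb P H (n + 1) i j = ∑' k, tabooProb P H n i k * P k j := by
  simp [tabooProb, hj]

theorem tsum_tabooProb_zero_mul (f : S → ℝ≥0∞) : ∑' k, tabooProb P H 0 i k * f k = f i := by
  rw [tsum_eq_single i fun k hk => by rw [tabooProb_zero_of_ne hk.symm, zero_mul],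
    tabooProb_zero_self, one_mul]

theorem tabooProb_succ_eq_tsum_compl (n : ℕ) :
    tabooProb P H (n + 1) i j = ∑' a : ↥Hᶜ, P i a * tabooProb P H n a j := by
  induction n generalizing j with
  | zero =>
    by_cases hj : j ∈ H
    · rw [tabooProb_succ_of_mem hj, eq_comm, ENNReal.tsum_eq_zero]
      intro a
      rw [tabooProb_zero_of_ne (ne_of_mem_of_not_mem hj a.2).symm, mul_zero]
    · rw [tabooProb_succ_of_notMem hj, tsum_tabooProb_zero_mul, tsum_eq_single ⟨j, hj⟩,
        tabooProb_zero_self, mul_one]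
      intro a ha
      rw [tabooProb_zero_of_ne fun h => ha (Subtype.ext h), mul_zero]
  | succ n ih =>
    by_cases hj : j ∈ H
    · simp only [tabooProb_succ_of_mem hj, mul_zero, tsum_zero]
    · rw [tabooProb_succ_of_notMem hj]
      simp only [ih, tabooProb_succ_of_notMem hj, ← ENNReal.tsum_mul_left,
        ← ENNReal.tsum_mul_right, mul_assoc]
      exact ENNReal.tsum_comm

theorem tabooGreen_self (hi : i ∈ H) : tabooGreen P H i i = 1 := by
  rw [tabooGreen, tsum_eq_zero_add' ENNReal.summable, tabooProb_zero_self]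
  simp only [tabooProb_succ_of_mem hi, tsum_zero, add_zero]

theorem tabooGreen_of_mem_of_ne (hj : j ∈ H) (hij : i ≠ j) : tabooGreen P H i j = 0 := by
  rw [tabooGreen, tsum_eq_zero_add' ENNReal.summable, tabooProb_zero_of_ne hij]
  simp only [tabooProb_succ_of_mem hj, tsum_zero, add_zero]

theorem entranceProb_eq_tabooGreen (hj : j ∉ H) (hij : i ≠ j) :
    entranceProb P H i j = tabooGreen P H i j := by
  rw [tabooGreen, tsum_eq_zero_add' ENNReal.summable, tabooProb_zero_of_ne hij, zero_add]
  simp only [tabooProb_succ_of_notMem hj, entranceProb]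

theorem tsum_tabooGreen_mul (i j : S) :
    ∑' k, tabooGreen P H i k * P k j = entranceProb P H i j := by
  rw [entranceProb, ENNReal.tsum_comm]
  simp only [ENNReal.tsum_mul_right, tabooGreen]

theorem entranceProb_eq_add_tsum_compl (i j : S) :
    entranceProb P H i j = P i j + ∑' a : ↥Hᶜ, P i a * entranceProb P H a j := by
  rw [entranceProb, tsum_eq_zero_add' ENNReal.summable, tsum_tabooProb_zero_mul]
  simp only [tabooProb_succ_eq_tsum_compl, entranceProb, ← ENNReal.tsum_mul_left,
    ← ENNReal.tsum_mul_right, mul_assoc]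
  congr 1
  calc ∑' n, ∑' k, ∑' a : ↥Hᶜ, P i a * (tabooProb P H n a k * P k j)
      = ∑' n, ∑' a : ↥Hᶜ, ∑' k, P i a * (tabooProb P H n a k * P k j) :=
        tsum_congr fun _ => ENNReal.tsum_comm
    _ = ∑' a : ↥Hᶜ, ∑' n, ∑' k, P i a * (tabooProb P H n a k * P k j) := ENNReal.tsum_comm

theorem tsum_mul_tabooGreen_of_mem (u : S → ℝ≥0∞) (hj : j ∈ H) :
    ∑' i : H, u i * tabooGreen P H i j = u j := by
  rw [tsum_eq_single ⟨j, hj⟩, tabooGreen_self hj, mul_one]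
  intro i hi
  rw [tabooGreen_of_mem_of_ne hj fun h => hi (Subtype.ext h), mul_zero]

theorem tsum_mul_tabooGreen_le {u : S → ℝ≥0∞} (hu : ∀ j ∉ H, ∑' k, u k * P k j ≤ u j) (j : S) :
    ∑' i : H, u i * tabooGreen P H i j ≤ u j := by
  by_cases hj : j ∈ H
  · exact (tsum_mul_tabooGreen_of_mem u hj).le
  have partial_sum_le (N : ℕ) (j : S) :
      ∑ n ∈ Finset.range N, ∑' i : H, u i * tabooProb P H n i j ≤ u j := by
    induction N generalizing j with
    | zero => simp
    | succ N ih =>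
      rw [Finset.sum_range_succ']
      by_cases hj : j ∈ H
      · simp only [tabooProb_succ_of_mem hj, mul_zero, tsum_zero, Finset.sum_const_zero, zero_add]
        rw [tsum_eq_single ⟨j, hj⟩, tabooProb_zero_self, mul_one]
        intro i hi
        rw [tabooProb_zero_of_ne fun h => hi (Subtype.ext h), mul_zero]
      · have start_eq_zero : ∑' i : H, u i * tabooProb P H 0 i j = 0 :=
          ENNReal.tsum_eq_zero.2 fun i => by
            rw [tabooProb_zero_of_ne (ne_of_mem_of_not_mem i.2 hj), mul_zero]
        have step (n : ℕ) : ∑' i : H, u i * tabooProb P H (n + 1) i j =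
            ∑' k, (∑' i : H, u i * tabooProb P H n i k) * P k j := by
          simp only [tabooProb_succ_of_notMem hj, ← ENNReal.tsum_mul_left,
            ← ENNReal.tsum_mul_right, mul_assoc]
          exact ENNReal.tsum_comm
        simp only [start_eq_zero, add_zero, step]
        rw [← Summable.tsum_finsetSum fun _ _ => ENNReal.summable]
        simp only [← Finset.sum_mul]
        exact (ENNReal.tsum_le_tsum fun k => mul_le_mul_left (ih k) _).trans (hu j hj)
  simp only [tabooGreen, ← ENNReal.tsum_mul_left]
  rw [ENNReal.tsum_comm, ENNReal.tsum_eq_iSup_nat]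
  exact iSup_le fun N => partial_sum_le N j

theorem mul_tabooGreen_le {u : S → ℝ≥0∞} (hu : ∀ j ∉ H, ∑' k, u k * P k j ≤ u j) (hi : i ∈ H)
    (j : S) : u i * tabooGreen P H i j ≤ u j :=
  (ENNReal.le_tsum (⟨i, hi⟩ : H)).trans (tsum_mul_tabooGreen_le hu j)

theorem tabooGreen_eq_zero (hi : i ∈ H) (hP : ∀ a ∉ H, P i a = 0) (hj : j ∉ H) :
    tabooGreen P H i j = 0 := by
  classical
  have hu (a : S) (ha : a ∉ H) :
      ∑' k, (Pi.single i 1 : S → ℝ≥0∞) k * P k a ≤ (Pi.single i 1 : S → ℝ≥0∞) a := by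
    rw [tsum_eq_single i fun k hk => by rw [Pi.single_eq_of_ne hk, zero_mul], hP a ha, mul_zero]
    exact zero_le
  simpa [Pi.single_eq_of_ne (ne_of_mem_of_not_mem hi hj).symm] using mul_tabooGreen_le hu hi j

/-- Decomposition of a path at its last visit to `H'`. -/
theorem tsum_tabooGreen_mul_tabooGreen (hH : H ⊆ H') (hi : i ∈ H) (s : S) :
    ∑' k : H', tabooGreen P H i k * tabooGreen P H' k s = tabooGreen P H i s := by
  set u : S → ℝ≥0∞ := fun s => ∑' k : H', tabooGreen P H i k * tabooGreen P H' k s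
  have green_step (t : S) (ht : t ∉ H) :
      ∑' k, tabooGreen P H i k * P k t = tabooGreen P H i t := by
    rw [tsum_tabooGreen_mul, entranceProb_eq_tabooGreen ht (ne_of_mem_of_not_mem hi ht)]
  have u_le (t : S) : u t ≤ tabooGreen P H i t :=
    tsum_mul_tabooGreen_le (fun t ht => (green_step t fun h => ht (hH h)).le) t
  have u_of_mem (t : S) (ht : t ∈ H') : u t = tabooGreen P H i t :=
    tsum_mul_tabooGreen_of_mem (tabooGreen P H i) ht
  have u_excessive (t : S) (ht : t ∉ H) : ∑' k, u k * P k t ≤ u t := by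
    by_cases ht' : t ∈ H'
    · rw [u_of_mem t ht', ← green_step t ht]
      gcongr with k
      exact u_le k
    · simp only [u, ← ENNReal.tsum_mul_right, mul_assoc]
      rw [ENNReal.tsum_comm]
      simp only [ENNReal.tsum_mul_left, tsum_tabooGreen_mul]
      gcongr with k
      exact (entranceProb_eq_tabooGreen ht' (ne_of_mem_of_not_mem k.2 ht')).le
  refine le_antisymm (u_le s) ?_
  simpa only [u_of_mem i (hH hi), tabooGreen_self hi, one_mul] using
    mul_tabooGreen_le u_excessive hi s

end TabooGreen

section Balance

variable {S : Type*} {Q : Matrix S S ℝ} {x y : S → ℝ≥0∞} {i j o s : S}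

open Classical in
/-- The rate of the jumps from `i` to `j`: the off-diagonal part of the generator `Q`, valued in
`ℝ≥0∞` so that sums of flows need no summability conditions. -/
noncomputable def jumpRate (Q : Matrix S S ℝ) (i j : S) : ℝ≥0∞ :=
  if i = j then 0 else ENNReal.ofReal (Q i j)

/-- The total rate of the jumps out of `j`. -/
noncomputable def exitRate (Q : Matrix S S ℝ) (j : S) : ℝ≥0∞ := ENNReal.ofReal (-Q j j)

/-- The probability flow into `s` under the measure `x`. -/
noncomputable def inflow (Q : Matrix S S ℝ) (x : S → ℝ≥0∞) (s : S) : ℝ≥0∞ :=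
  ∑' t, x t * jumpRate Q t s

/-- The probability flow out of `s` under the measure `x`; `x` is invariant when
`inflow Q x = outflow Q x`. -/
noncomputable def outflow (Q : Matrix S S ℝ) (x : S → ℝ≥0∞) (s : S) : ℝ≥0∞ :=
  x s * exitRate Q s

theorem jumpRate_of_ne (hij : i ≠ j) : jumpRate Q i j = ENNReal.ofReal (Q i j) := if_neg hij

theorem exitRate_ne_top : exitRate Q i ≠ ∞ := ENNReal.ofReal_ne_top

theorem exitRate_ne_zero (hq : ∀ i, Q i i < 0) (i : S) : exitRate Q i ≠ 0 := by
  simpa [exitRate] using hq i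

theorem jumpProb_eq_zero (hij : i ≠ j) (hQ : Q i j = 0) : jumpProb Q i j = 0 := by
  simp [jumpProb, hij, hQ]

theorem exitRate_mul_jumpProb (hq : ∀ i, Q i i < 0) (i j : S) :
    exitRate Q i * jumpProb Q i j = jumpRate Q i j := by
  by_cases hij : i = j
  · simp [jumpProb, jumpRate, hij, (hq j).ne]
  · have hpos : 0 < -Q i i := neg_pos.2 (hq i)
    simp only [jumpProb, jumpRate, hij, (hq i).ne, if_false]
    rw [ENNReal.ofReal_div_of_pos hpos]
    exact ENNReal.mul_div_cancel (exitRate_ne_zero hq i) exitRate_ne_top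

theorem tsum_outflow_mul_jumpProb (hq : ∀ i, Q i i < 0) (x : S → ℝ≥0∞) (s : S) :
    ∑' t, outflow Q x t * jumpProb Q t s = inflow Q x s := by
  simp only [outflow, mul_assoc, exitRate_mul_jumpProb hq, inflow]

theorem outflow_ne_top (hx : x s ≠ ∞) : outflow Q x s ≠ ∞ := ENNReal.mul_ne_top hx exitRate_ne_top

theorem inflow_mono (hxy : x ≤ y) : inflow Q x ≤ inflow Q y := fun _ =>
  ENNReal.tsum_le_tsum fun t => mul_le_mul_left (hxy t) _

theorem inflow_add : inflow Q (x + y) = inflow Q x + inflow Q y := by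
  funext s
  simp only [inflow, Pi.add_apply, add_mul, ENNReal.tsum_add]

theorem inflow_sub_le_outflow (hx : inflow Q x ≤ outflow Q x) (hy : inflow Q y = outflow Q y)
    (hyx : y ≤ x) (hy_fin : ∀ s, y s ≠ ∞) : inflow Q (x - y) ≤ outflow Q (x - y) := by
  intro s
  refine (ENNReal.add_le_add_iff_right (outflow_ne_top (Q := Q) (hy_fin s))).1 ?_
  calc inflow Q (x - y) s + outflow Q y s
      = inflow Q (x - y + y) s := by rw [← hy, inflow_add, Pi.add_apply]
    _ ≤ outflow Q (x - y + y) s := by rw [tsub_add_cancel_of_le hyx]; exact hx s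
    _ = outflow Q (x - y) s + outflow Q y s := add_mul _ _ _

theorem eq_zero_of_inflow_le_outflow (hirr : IsIrreducibleGenerator Q)
    (hx : inflow Q x ≤ outflow Q x) (ho : x o = 0) (s : S) : x s = 0 := by
  refine Relation.ReflTransGen.head_induction_on (hirr s o) ho ?_
  intro a b hab _ hb
  have flow_le : x a * jumpRate Q a b ≤ 0 := by
    simpa [outflow, hb] using (ENNReal.le_tsum a).trans (hx b)
  have rate_ne_zero : jumpRate Q a b ≠ 0 := by simpa [jumpRate_of_ne hab.1] using hab.2
  simpa [rate_ne_zero] using flow_le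

theorem ne_top_of_inflow_le_outflow (hirr : IsIrreducibleGenerator Q)
    (hx : inflow Q x ≤ outflow Q x) (ho : x o ≠ ∞) (s : S) : x s ≠ ∞ := by
  refine Relation.ReflTransGen.head_induction_on (hirr s o) ho ?_
  intro a b hab _ hb ha
  have rate_ne_zero : jumpRate Q a b ≠ 0 := by simpa [jumpRate_of_ne hab.1] using hab.2
  have flow_le : x a * jumpRate Q a b ≤ outflow Q x b := (ENNReal.le_tsum a).trans (hx b)
  rw [ha, ENNReal.top_mul rate_ne_zero, top_le_iff] at flow_le
  exact outflow_ne_top hb flow_le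

theorem IsGenerator.diag_neg_of_irreducible [Nontrivial S] (hgen : IsGenerator Q)
    (hirr : IsIrreducibleGenerator Q) (i : S) : Q i i < 0 := by
  classical
  obtain ⟨j, hj⟩ := exists_ne i
  obtain rfl | ⟨a, ⟨hia, ha_pos⟩, -⟩ := (hirr i j).cases_head
  · exact absurd rfl hj
  have off_diag : HasSum (Function.update (Q i) i 0) (0 - Q i i + 0) := (hgen.2 i).update i 0
  have entry_le := le_hasSum off_diag a fun k _ => by
    obtain rfl | hk := eq_or_ne k i
    · rw [Function.update_self]
    · rw [Function.update_of_ne hk]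
      exact hgen.1 i k hk.symm
  rw [Function.update_of_ne hia.symm] at entry_le
  linarith

theorem hasSum_toReal_mul_generator (hgen : IsGenerator Q) (hx : inflow Q x j ≠ ∞) :
    HasSum (fun i => (x i).toReal * Q i j) ((inflow Q x j).toReal + (x j).toReal * Q j j) := by
  classical
  have hsum := (ENNReal.hasSum_toReal hx).add (hasSum_ite_eq j ((x j).toReal * Q j j))
  rw [← ENNReal.tsum_toReal_eq (ENNReal.ne_top_of_tsum_ne_top hx)] at hsum
  refine hsum.congr_fun fun i => ?_
  obtain rfl | hij := eq_or_ne i j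
  · simp [jumpRate]
  · simp [jumpRate_of_ne hij, hij, ENNReal.toReal_ofReal (hgen.1 i j hij)]

theorem hasSum_toReal_mul_generator_zero (hgen : IsGenerator Q) (hq : ∀ i, Q i i < 0)
    (hx : x j ≠ ∞) (hbal : inflow Q x j = outflow Q x j) :
    HasSum (fun i => (x i).toReal * Q i j) 0 := by
  have hsum := hasSum_toReal_mul_generator hgen (hbal ▸ outflow_ne_top hx)
  rwa [hbal, outflow, ENNReal.toReal_mul, exitRate, ENNReal.toReal_ofReal (neg_pos.2 (hq j)).le,
    mul_neg, neg_add_cancel] at hsum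

theorem inflow_ofReal_eq_outflow (hgen : IsGenerator Q) {x : S → ℝ} (hx : ∀ i, 0 ≤ x i)
    (hsum : HasSum (fun i => x i * Q i j) 0) :
    inflow Q (fun i => ENNReal.ofReal (x i)) j = outflow Q (fun i => ENNReal.ofReal (x i)) j := by
  classical
  set g := Function.update (fun i => x i * Q i j) j 0 with hg
  have g_sum : HasSum g (x j * -Q j j) := by simpa using hsum.update j 0
  have g_of_ne {i : S} (hij : i ≠ j) : g i = x i * Q i j := Function.update_of_ne hij _ _
  have g_nonneg (i : S) : 0 ≤ g i := by
    obtain rfl | hij := eq_or_ne i j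
    · simp [hg]
    · exact g_of_ne hij ▸ mul_nonneg (hx i) (hgen.1 i j hij)
  calc inflow Q (fun i => ENNReal.ofReal (x i)) j = ∑' i, ENNReal.ofReal (g i) := by
        refine tsum_congr fun i => ?_
        obtain rfl | hij := eq_or_ne i j
        · simp [hg, jumpRate]
        · rw [g_of_ne hij, jumpRate_of_ne hij, ENNReal.ofReal_mul (hx i)]
    _ = ENNReal.ofReal (x j * -Q j j) := by
        rw [← ENNReal.ofReal_tsum_of_nonneg g_nonneg g_sum.summable, g_sum.tsum_eq]
    _ = outflow Q (fun i => ENNReal.ofReal (x i)) j := ENNReal.ofReal_mul (hx j)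

end Balance

section Balayage

variable {S : Type*} {Q : Matrix S S ℝ} {H H' : Set S} {x : S → ℝ≥0∞} {i j o s : S}

/-- For `i ∈ H`: the expected time spent in `s` before the next jump into `H`, per unit of time
spent in `i`. Dividing the expected numbers of visits by the exit rates turns them into times. -/
noncomputable def sojournTime (Q : Matrix S S ℝ) (H : Set S) (i s : S) : ℝ≥0∞ :=
  exitRate Q i * tabooGreen (jumpProb Q) H i s / exitRate Q s

/-- The balayage of the measure `x` on `H`: the measure that agrees with `x` on `H`, and whose mass
outside `H` is accumulated by the excursions from `H`. -/
noncomputable def balayage (Q : Matrix S S ℝ) (H : Set S) (x : S → ℝ≥0∞) (s : S) : ℝ≥0∞ :=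
  ∑' i : H, x i * sojournTime Q H i s

theorem sojournTime_self (hq : ∀ i, Q i i < 0) (hi : i ∈ H) : sojournTime Q H i i = 1 := by
  rw [sojournTime, tabooGreen_self hi, mul_one,
    ENNReal.div_self (exitRate_ne_zero hq i) exitRate_ne_top]

theorem sojournTime_of_mem_of_ne (hs : s ∈ H) (his : i ≠ s) : sojournTime Q H i s = 0 := by
  rw [sojournTime, tabooGreen_of_mem_of_ne hs his, mul_zero, ENNReal.zero_div]

theorem sojournTime_eq_zero (hi : i ∈ H) (hQ : ∀ a ∉ H, Q i a = 0) (hs : s ∉ H) :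
    sojournTime Q H i s = 0 := by
  rw [sojournTime, tabooGreen_eq_zero hi
    (fun a ha => jumpProb_eq_zero (ne_of_mem_of_not_mem hi ha) (hQ a ha)) hs, mul_zero,
    ENNReal.zero_div]

theorem outflow_sojournTime (hq : ∀ i, Q i i < 0) (i s : S) :
    outflow Q (sojournTime Q H i) s = exitRate Q i * tabooGreen (jumpProb Q) H i s :=
  ENNReal.div_mul_cancel (exitRate_ne_zero hq s) exitRate_ne_top

theorem inflow_sojournTime (hq : ∀ i, Q i i < 0) (i s : S) :
    inflow Q (sojournTime Q H i) s = exitRate Q i * entranceProb (jumpProb Q) H i s := by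
  rw [← tsum_outflow_mul_jumpProb hq]
  simp only [outflow_sojournTime hq, mul_assoc, ENNReal.tsum_mul_left, tsum_tabooGreen_mul]

theorem inflow_sojournTime_of_notMem (hq : ∀ i, Q i i < 0) (hi : i ∈ H) (hs : s ∉ H) :
    inflow Q (sojournTime Q H i) s = outflow Q (sojournTime Q H i) s := by
  rw [inflow_sojournTime hq, outflow_sojournTime hq,
    entranceProb_eq_tabooGreen hs (ne_of_mem_of_not_mem hi hs)]

theorem balayage_eq_div (x : S → ℝ≥0∞) (s : S) :
    balayage Q H x s =
      (∑' i : H, outflow Q x i * tabooGreen (jumpProb Q) H i s) / exitRate Q s := by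
  simp only [balayage, sojournTime, outflow, div_eq_mul_inv, ← ENNReal.tsum_mul_right, mul_assoc]

theorem balayage_of_mem (hq : ∀ i, Q i i < 0) (x : S → ℝ≥0∞) (hs : s ∈ H) :
    balayage Q H x s = x s := by
  rw [balayage_eq_div, tsum_mul_tabooGreen_of_mem _ hs, outflow,
    ENNReal.mul_div_cancel_right (exitRate_ne_zero hq s) exitRate_ne_top]

theorem balayage_le (hq : ∀ i, Q i i < 0) (hx : ∀ s ∉ H, inflow Q x s ≤ outflow Q x s) :
    balayage Q H x ≤ x := by
  intro s
  rw [balayage_eq_div]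
  refine ENNReal.div_le_of_le_mul (tsum_mul_tabooGreen_le (fun s hs => ?_) s)
  rw [tsum_outflow_mul_jumpProb hq]
  exact hx s hs

theorem mul_sojournTime_le (hq : ∀ i, Q i i < 0) (hx : ∀ s ∉ H, inflow Q x s ≤ outflow Q x s)
    (hi : i ∈ H) (s : S) : x i * sojournTime Q H i s ≤ x s :=
  (ENNReal.le_tsum (⟨i, hi⟩ : H)).trans (balayage_le hq hx s)

theorem inflow_balayage (x : S → ℝ≥0∞) (s : S) :
    inflow Q (balayage Q H x) s = ∑' i : H, x i * inflow Q (sojournTime Q H i) s := by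
  simp only [inflow, balayage, ← ENNReal.tsum_mul_right, ← ENNReal.tsum_mul_left, mul_assoc]
  exact ENNReal.tsum_comm

theorem inflow_balayage_of_notMem (hq : ∀ i, Q i i < 0) (x : S → ℝ≥0∞) (hs : s ∉ H) :
    inflow Q (balayage Q H x) s = outflow Q (balayage Q H x) s := by
  rw [inflow_balayage, outflow, balayage, ← ENNReal.tsum_mul_right]
  exact tsum_congr fun i => by rw [inflow_sojournTime_of_notMem hq i.2 hs, outflow, mul_assoc]

theorem inflow_balayage_le_outflow (hq : ∀ i, Q i i < 0) (hx : inflow Q x ≤ outflow Q x) :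
    inflow Q (balayage Q H x) ≤ outflow Q (balayage Q H x) := by
  intro s
  by_cases hs : s ∈ H
  · calc inflow Q (balayage Q H x) s ≤ inflow Q x s :=
          inflow_mono (balayage_le hq fun t _ => hx t) s
      _ ≤ outflow Q x s := hx s
      _ = outflow Q (balayage Q H x) s := by rw [outflow, outflow, balayage_of_mem hq x hs]
  · exact (inflow_balayage_of_notMem hq x hs).le

theorem balayage_sojournTime (hq : ∀ i, Q i i < 0) (hH : H ⊆ H') (hi : i ∈ H) :
    balayage Q H' (sojournTime Q H i) = sojournTime Q H i := by
  funext s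
  rw [balayage_eq_div]
  simp only [outflow_sojournTime hq, mul_assoc, ENNReal.tsum_mul_left,
    tsum_tabooGreen_mul_tabooGreen hH hi, sojournTime]

theorem inflow_sojournTime_singleton (hq : ∀ i, Q i i < 0) (hret : returnProb Q o = 1) :
    inflow Q (sojournTime Q {o} o) = outflow Q (sojournTime Q {o} o) := by
  funext s
  obtain rfl | hs := eq_or_ne s o
  · rw [inflow_sojournTime hq, outflow_sojournTime hq, tabooGreen_self (Set.mem_singleton s)]
    exact congrArg _ hret
  · exact inflow_sojournTime_of_notMem hq (Set.mem_singleton o) hs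

theorem sojournTime_le_singleton (hq : ∀ i, Q i i < 0) (hret : returnProb Q i = 1) (hi : i ∈ H) :
    sojournTime Q H i ≤ sojournTime Q {i} i := fun s => by
  simpa only [sojournTime_self hq (Set.mem_singleton i), one_mul] using
    mul_sojournTime_le hq (fun t _ => (congrFun (inflow_sojournTime_singleton hq hret) t).le) hi s

theorem sojournTime_ne_top (hirr : IsIrreducibleGenerator Q) (hq : ∀ i, Q i i < 0)
    (hret : returnProb Q i = 1) (hi : i ∈ H) (s : S) : sojournTime Q H i s ≠ ∞ := by
  refine ne_top_of_le_ne_top ?_ (sojournTime_le_singleton hq hret hi s)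
  refine ne_top_of_inflow_le_outflow hirr (inflow_sojournTime_singleton hq hret).le (o := i) ?_ s
  rw [sojournTime_self hq (Set.mem_singleton i)]
  exact ENNReal.one_ne_top

theorem inflow_sojournTime_ne_top (hirr : IsIrreducibleGenerator Q) (hq : ∀ i, Q i i < 0)
    (hret : returnProb Q i = 1) (hi : i ∈ H) (s : S) : inflow Q (sojournTime Q H i) s ≠ ∞ := by
  refine ne_top_of_le_ne_top ?_ (inflow_mono (sojournTime_le_singleton hq hret hi) s)
  rw [inflow_sojournTime_singleton hq hret]
  exact outflow_ne_top (sojournTime_ne_top hirr hq hret (Set.mem_singleton i) s)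

theorem tsum_sojournTime_singleton (o : S) :
    ∑' s, sojournTime Q {o} o s = exitRate Q o * meanReturnTime Q o := by
  rw [meanReturnTime, ENNReal.tsum_comm]
  simp only [sojournTime, tabooGreen, exitRate, div_eq_mul_inv, mul_assoc, ENNReal.tsum_mul_left,
    ENNReal.tsum_mul_right]

theorem eq_mul_sojournTime_singleton (hirr : IsIrreducibleGenerator Q) (hq : ∀ i, Q i i < 0)
    (hret : returnProb Q o = 1) (hx : inflow Q x ≤ outflow Q x) (ho_fin : x o ≠ ∞) (s : S) :
    x s = x o * sojournTime Q {o} o s := by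
  set w : S → ℝ≥0∞ := balayage Q {o} x
  have hx_fin (t : S) : x t ≠ ∞ := ne_top_of_inflow_le_outflow hirr hx ho_fin t
  have w_eq (t : S) : w t = x o * sojournTime Q {o} o t :=
    tsum_singleton o fun i => x i * sojournTime Q {o} i t
  have w_le : w ≤ x := balayage_le hq fun t _ => hx t
  have w_o : w o = x o := balayage_of_mem hq x (Set.mem_singleton o)
  have w_invariant : inflow Q w = outflow Q w := by
    funext t
    have h := congrFun (inflow_sojournTime_singleton hq hret) t
    calc inflow Q w t = x o * inflow Q (sojournTime Q {o} o) t := by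
          simp only [inflow, w_eq, mul_assoc, ENNReal.tsum_mul_left]
      _ = outflow Q w t := by rw [h, outflow, outflow, w_eq, mul_assoc]
  have sub_eq_zero := eq_zero_of_inflow_le_outflow hirr (o := o)
    (inflow_sub_le_outflow hx w_invariant w_le fun t => ne_top_of_le_ne_top (hx_fin t) (w_le t))
    (by rw [Pi.sub_apply, w_o, tsub_self]) s
  rw [← w_eq]
  exact le_antisymm (tsub_eq_zero_iff_le.1 sub_eq_zero) (w_le s)

theorem balayage_eq_self (hirr : IsIrreducibleGenerator Q) (hq : ∀ i, Q i i < 0) (ho : o ∈ H)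
    (hret : returnProb Q o = 1) (hx : inflow Q x ≤ outflow Q x) (ho_fin : x o ≠ ∞) :
    balayage Q H x = x := by
  funext s
  have balayage_o : balayage Q H x o = x o := balayage_of_mem hq x ho
  rw [eq_mul_sojournTime_singleton hirr hq hret (inflow_balayage_le_outflow hq hx)
    (balayage_o ▸ ho_fin) s, balayage_o, ← eq_mul_sojournTime_singleton hirr hq hret hx ho_fin s]

theorem inflow_sojournTime_eq_add (hq : ∀ i, Q i i < 0) (hi : i ∈ H) (j : S) :
    inflow Q (sojournTime Q H i) j = jumpRate Q i j +
      ∑' a : ↥Hᶜ, ENNReal.ofReal (Q i a) * entranceProb (jumpProb Q) H a j := by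
  rw [inflow_sojournTime hq, entranceProb_eq_add_tsum_compl, mul_add, exitRate_mul_jumpProb hq,
    ← ENNReal.tsum_mul_left]
  congr 1
  refine tsum_congr fun a => ?_
  rw [← mul_assoc, exitRate_mul_jumpProb hq, jumpRate_of_ne (ne_of_mem_of_not_mem hi a.2)]

theorem censoredGenerator_eq (i j : S) :
    censoredGenerator Q H i j = Q i j +
      (∑' a : ↥Hᶜ, ENNReal.ofReal (Q i a) * entranceProb (jumpProb Q) H a j).toReal := by
  classical
  rw [censoredGenerator,
    tsum_subtype Hᶜ fun a => ENNReal.ofReal (Q i a) * entranceProb (jumpProb Q) H a j]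
  congr 3 with a
  simp only [Set.indicator, Set.mem_compl_iff, ite_not]

theorem hasSum_sojournTime_mul_generator (hgen : IsGenerator Q) (hq : ∀ i, Q i i < 0)
    (hi : i ∈ H) (hj : j ∈ H) (hfin : inflow Q (sojournTime Q H i) j ≠ ∞) :
    HasSum (fun t => (sojournTime Q H i t).toReal * Q t j) (censoredGenerator Q H i j) := by
  have hsum := hasSum_toReal_mul_generator hgen hfin
  rw [inflow_sojournTime_eq_add hq hi] at hsum hfin
  rw [ENNReal.toReal_add (ENNReal.add_ne_top.1 hfin).1 (ENNReal.add_ne_top.1 hfin).2] at hsum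
  rw [censoredGenerator_eq]
  convert hsum using 1
  obtain rfl | hij := eq_or_ne i j
  · simp [sojournTime_self hq hi, jumpRate, add_comm]
  · simp [sojournTime_of_mem_of_ne hj hij, jumpRate_of_ne hij,
      ENNReal.toReal_ofReal (hgen.1 i j hij)]

end Balayage

section Stationary

variable {S : Type*} {Q : Matrix S S ℝ} {x y : S → ℝ}

/-- An irreducible recurrent Markov chain without absorbing states: what is needed for its
excursions from a set to be almost surely finite. -/
structure IsIrreducibleRecurrent (Q : Matrix S S ℝ) : Prop where
  isGenerator : IsGenerator Q
  irreducible : IsIrreducibleGenerator Q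
  diag_neg : ∀ i, Q i i < 0
  returnProb_eq_one : ∀ i, returnProb Q i = 1

/-- A nonnegative vector `x` with `x Q = 0`. -/
structure IsInvariantVector (Q : Matrix S S ℝ) (x : S → ℝ) : Prop where
  nonneg : ∀ i, 0 ≤ x i
  hasSum_zero : ∀ j, HasSum (fun i => x i * Q i j) 0

theorem IsStationaryVector.isInvariantVector (hx : IsStationaryVector Q x) :
    IsInvariantVector Q x :=
  ⟨hx.1, hx.2.2⟩

theorem IsInvariantVector.inflow_eq_outflow (hgen : IsGenerator Q) (hx : IsInvariantVector Q x) :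
    inflow Q (fun s => ENNReal.ofReal (x s)) = outflow Q (fun s => ENNReal.ofReal (x s)) :=
  funext fun j => inflow_ofReal_eq_outflow hgen hx.nonneg (hx.hasSum_zero j)

theorem IsInvariantVector.isStationaryVector_div (hx : IsInvariantVector Q x) {Z : ℝ}
    (hsum : HasSum x Z) (hZ : Z ≠ 0) : IsStationaryVector Q fun s => x s / Z := by
  refine ⟨fun s => div_nonneg (hx.nonneg s) (hsum.nonneg hx.nonneg), ?_, fun j => ?_⟩
  · simpa only [div_self hZ] using hsum.div_const Z
  · simpa only [zero_div, mul_div_right_comm] using (hx.hasSum_zero j).div_const Z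

theorem IsStationaryVector.pos (hgen : IsGenerator Q) (hirr : IsIrreducibleGenerator Q)
    (hx : IsStationaryVector Q x) (s : S) : 0 < x s := by
  refine (hx.1 s).lt_of_ne' fun hs => zero_ne_one (α := ℝ) ?_
  refine hasSum_zero.unique (hx.2.1.congr_fun fun t => ?_)
  have ofReal_eq_zero := eq_zero_of_inflow_le_outflow hirr
    (hx.isInvariantVector.inflow_eq_outflow hgen).le (o := s) (by rw [hs, ENNReal.ofReal_zero]) t
  exact (le_antisymm (ENNReal.ofReal_eq_zero.1 ofReal_eq_zero) (hx.1 t)).symm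

namespace IsIrreducibleRecurrent

theorem of_isPositiveRecurrent [Nontrivial S] (hgen : IsGenerator Q)
    (hirr : IsIrreducibleGenerator Q) (hrec : IsPositiveRecurrent Q) :
    IsIrreducibleRecurrent Q where
  isGenerator := hgen
  irreducible := hirr
  diag_neg := hgen.diag_neg_of_irreducible hirr
  returnProb_eq_one i := ((hrec i).resolve_left (hgen.diag_neg_of_irreducible hirr i).ne).1

theorem eq_div_mul_of_isInvariantVector (h : IsIrreducibleRecurrent Q)
    (hx : IsInvariantVector Q x) (hy : IsInvariantVector Q y) {o : S} (ho : x o ≠ 0) (s : S) :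
    y s = y o / x o * x s := by
  have eq_mul {z : S → ℝ} (hz : IsInvariantVector Q z) :
      z s = z o * (sojournTime Q {o} o s).toReal := by
    simpa only [ENNReal.toReal_mul, ENNReal.toReal_ofReal (hz.nonneg _)] using
      congrArg ENNReal.toReal (eq_mul_sojournTime_singleton h.irreducible h.diag_neg
        (h.returnProb_eq_one o) (hz.inflow_eq_outflow h.isGenerator).le ENNReal.ofReal_ne_top s)
  rw [eq_mul hy, eq_mul hx, ← mul_assoc, div_mul_cancel₀ _ ho]

theorem isStationaryVector_unique (h : IsIrreducibleRecurrent Q) (hx : IsStationaryVector Q x)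
    (hy : IsStationaryVector Q y) : y = x := by
  funext s
  have y_eq := h.eq_div_mul_of_isInvariantVector hx.isInvariantVector hy.isInvariantVector
    (hx.pos h.isGenerator h.irreducible s).ne'
  have ratio_eq_one : y s / x s * 1 = 1 := ((hx.2.1.mul_left _).congr_fun y_eq).unique hy.2.1
  rw [y_eq s, ← mul_one (y s / x s), ratio_eq_one, one_mul]

theorem exists_isStationaryVector (h : IsIrreducibleRecurrent Q) {o : S}
    (hmean : meanReturnTime Q o < ∞) : ∃ x, IsStationaryVector Q x := by
  set w := sojournTime Q {o} o
  have w_fin (s : S) : w s ≠ ∞ :=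
    sojournTime_ne_top h.irreducible h.diag_neg (h.returnProb_eq_one o) (Set.mem_singleton o) s
  have w_o : w o = 1 := sojournTime_self h.diag_neg (Set.mem_singleton o)
  have total_ne_top : ∑' s, w s ≠ ∞ := by
    rw [tsum_sojournTime_singleton]
    exact ENNReal.mul_ne_top exitRate_ne_top hmean.ne
  have w_invariant : IsInvariantVector Q fun s => (w s).toReal :=
    ⟨fun _ => ENNReal.toReal_nonneg, fun j => hasSum_toReal_mul_generator_zero h.isGenerator
      h.diag_neg (w_fin j)
      (congrFun (inflow_sojournTime_singleton h.diag_neg (h.returnProb_eq_one o)) j)⟩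
  have w_sum := ENNReal.hasSum_toReal total_ne_top
  have one_le_total : 1 ≤ ∑' s, (w s).toReal := by
    simpa [w_o] using le_hasSum w_sum o fun _ _ => ENNReal.toReal_nonneg
  exact ⟨_, w_invariant.isStationaryVector_div w_sum (zero_lt_one.trans_le one_le_total).ne'⟩

end IsIrreducibleRecurrent

end Stationary

section RSequences

variable {m₀ m : ℕ} {R : RSequence m₀ m} {x : QBDState m₀ m → ℝ}

theorem hasSum_sigma_of_fst_notMem {M ι : Type*} [AddCommMonoid M] [TopologicalSpace M]
    {κ : ι → Type*} [∀ k, Fintype (κ k)] (F : Finset ι) {f : (Σ k, κ k) → M}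
    (hf : ∀ s, s.1 ∉ F → f s = 0) : HasSum f (∑ k ∈ F, ∑ i, f ⟨k, i⟩) := by
  rw [Finset.sum_sigma' F (fun _ => Finset.univ) (fun k i => f ⟨k, i⟩)]
  exact hasSum_sum_of_ne_finset_zero fun s hs => hf s fun h => hs (by simpa using h)

/-- The subvector of `x` on level `k`, written `x_k` in the paper. -/
def levelVec (x : QBDState m₀ m → ℝ) (k : ℕ) : Fin (levelSize m₀ m k) → ℝ := fun i => x ⟨k, i⟩

/-- The vector whose part on a level `k ≥ l` is `w R_l R_{l+1} ⋯ R_{k-1}`, and which vanishes on the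
levels below `l`. -/
noncomputable def vecProd (R : RSequence m₀ m) (l : ℕ) (w : Fin (levelSize m₀ m l) → ℝ) :
    QBDState m₀ m → ℝ :=
  fun s => go s.1 s.2
where
  /-- The part of `vecProd R l w` on each level. -/
  go : ∀ k, Fin (levelSize m₀ m k) → ℝ
  | 0 => Function.update (0 : ∀ k, Fin (levelSize m₀ m k) → ℝ) l w 0
  | k + 1 => go k ᵥ* R k + Function.update (0 : ∀ k, Fin (levelSize m₀ m k) → ℝ) l w (k + 1)

theorem levelVec_vecProd_zero (l : ℕ) (w : Fin (levelSize m₀ m l) → ℝ) :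
    levelVec (vecProd R l w) 0 = Function.update (0 : ∀ k, Fin (levelSize m₀ m k) → ℝ) l w 0 := rfl

theorem levelVec_vecProd_add_one (l : ℕ) (w : Fin (levelSize m₀ m l) → ℝ) (k : ℕ) :
    levelVec (vecProd R l w) (k + 1) = levelVec (vecProd R l w) k ᵥ* R k +
      Function.update (0 : ∀ k, Fin (levelSize m₀ m k) → ℝ) l w (k + 1) := rfl

theorem levelVec_vecProd_of_lt {l k : ℕ} {w : Fin (levelSize m₀ m l) → ℝ} (hk : k < l) :
    levelVec (vecProd R l w) k = 0 := by
  induction k with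
  | zero => rw [levelVec_vecProd_zero, Function.update_of_ne hk.ne, Pi.zero_apply]
  | succ k ih =>
    rw [levelVec_vecProd_add_one, ih (by omega), Matrix.zero_vecMul, Function.update_of_ne hk.ne,
      Pi.zero_apply, add_zero]

theorem levelVec_vecProd_self (l : ℕ) (w : Fin (levelSize m₀ m l) → ℝ) :
    levelVec (vecProd R l w) l = w := by
  cases l with
  | zero => rw [levelVec_vecProd_zero, Function.update_self]
  | succ l =>
    rw [levelVec_vecProd_add_one, levelVec_vecProd_of_lt l.lt_succ_self, Matrix.zero_vecMul,
      zero_add, Function.update_self]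

theorem levelVec_vecProd_of_le {l k : ℕ} (hk : l ≤ k) (w : Fin (levelSize m₀ m l) → ℝ) :
    levelVec (vecProd R l w) (k + 1) = levelVec (vecProd R l w) k ᵥ* R k := by
  rw [levelVec_vecProd_add_one, Function.update_of_ne (by omega), Pi.zero_apply, add_zero]

theorem vecProd_nonneg (hR : ∀ l i j, 0 ≤ R l i j) {l : ℕ} {w : Fin (levelSize m₀ m l) → ℝ}
    (hw : 0 ≤ w) (s : QBDState m₀ m) : 0 ≤ vecProd R l w s := by
  have source_nonneg : 0 ≤ Function.update (0 : ∀ k, Fin (levelSize m₀ m k) → ℝ) l w :=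
    le_update_iff.2 ⟨hw, fun _ _ => le_rfl⟩
  obtain ⟨k, i⟩ := s
  induction k with
  | zero => exact source_nonneg 0 i
  | succ k ih =>
    have step_nonneg : 0 ≤ ∑ a, vecProd R l w ⟨k, a⟩ * R k a i :=
      Finset.sum_nonneg fun a _ => mul_nonneg (ih a) (hR k a i)
    exact add_nonneg step_nonneg (source_nonneg (k + 1) i)

theorem rProd_nonneg (hR : ∀ l i j, 0 ≤ R l i j) (k l : ℕ) (i : Fin (levelSize m₀ m k))
    (j : Fin m) : 0 ≤ rProd R k l i j := by
  induction l generalizing j with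
  | zero => exact hR k i j
  | succ l ih =>
    rw [rProd, Matrix.mul_apply]
    exact Finset.sum_nonneg fun a _ => mul_nonneg (ih a) (hR (k + l + 1) a j)

theorem levelVec_vecMul_rProd (hx : ∀ k, levelVec x (k + 1) = levelVec x k ᵥ* R k) (k l : ℕ) :
    (levelVec x k ᵥ* rProd R k l : Fin m → ℝ) = levelVec x (k + l + 1) := by
  induction l with
  | zero => exact (hx k).symm
  | succ l ih =>
    rw [rProd, ← Matrix.vecMul_vecMul, ih]
    exact (hx (k + l + 1)).symm

theorem levelVec_zero_vecMul_rProd (hx : ∀ k, levelVec x (k + 1) = levelVec x k ᵥ* R k) (k : ℕ) :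
    (levelVec x 0 ᵥ* rProd R 0 k : Fin m → ℝ) = levelVec x (k + 1) := by
  rw [levelVec_vecMul_rProd hx, Nat.zero_add]

theorem hasSum_vecMul_rSeries {k : ℕ} (hR : Summable (rProd R k))
    (w : Fin (levelSize m₀ m k) → ℝ) (j : Fin m) :
    HasSum (fun l => (w ᵥ* rProd R k l) j) ((w ᵥ* rSeries R k) j) :=
  hasSum_sum (f := fun i l => w i * rProd R k l i j) (s := Finset.univ) fun i _ =>
    (Pi.hasSum.1 (Pi.hasSum.1 hR.hasSum i) j).mul_left (w i)

/-- The summands satisfy `x_k (R_k ⋯ R_{k+l}) = x_{k+l+1}`, and `x` is summable and positive. -/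
theorem summable_rProd (hR : ∀ l i j, 0 ≤ R l i j)
    (hx : ∀ k, levelVec x (k + 1) = levelVec x k ᵥ* R k) (hx_pos : ∀ s, 0 < x s)
    (hsum : Summable x) (k : ℕ) : Summable (rProd R k) := by
  refine Pi.summable.2 fun i => Pi.summable.2 fun j => ?_
  have summable_tail : Summable fun l => x ⟨k + l + 1, j⟩ :=
    hsum.comp_injective (i := fun l => (⟨k + l + 1, j⟩ : QBDState m₀ m)) fun a b hab => by
      have := congrArg Sigma.fst hab
      dsimp only at this
      omega
  refine Summable.of_nonneg_of_le (fun l => rProd_nonneg hR k l i j) (fun l => ?_)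
    (summable_tail.mul_left (x ⟨k, i⟩)⁻¹)
  rw [le_inv_mul_iff₀ (hx_pos _)]
  calc x ⟨k, i⟩ * rProd R k l i j ≤ (levelVec x k ᵥ* rProd R k l) j :=
        Finset.single_le_sum (f := fun a => x ⟨k, a⟩ * rProd R k l a j)
          (fun a _ => mul_nonneg (hx_pos _).le (rProd_nonneg hR k l a j)) (Finset.mem_univ i)
    _ = x ⟨k + l + 1, j⟩ := congrFun (levelVec_vecMul_rProd hx k l) j

theorem hasSum_tail (hx : ∀ k, levelVec x (k + 1) = levelVec x k ᵥ* R k) {k : ℕ}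
    (hR : Summable (rProd R (k + 1))) (j : Fin m) :
    HasSum (fun n : ℕ => x ⟨k + n + 1, j⟩)
      (((levelVec x (k + 1) : Fin m → ℝ) ᵥ*
        ((1 : Matrix (Fin m) (Fin m) ℝ) + rSeries R (k + 1))) j) := by
  rw [Matrix.vecMul_add, Matrix.vecMul_one]
  refine HasSum.zero_add (f := fun n : ℕ => x ⟨k + n + 1, j⟩) ?_
  refine (hasSum_vecMul_rSeries hR (levelVec x (k + 1)) j).congr_fun fun n => ?_
  rw [levelVec_vecMul_rProd hx, levelVec]
  congr! 2
  omega

theorem eq_add_sum_rSeries_of_hasSum {c : ℝ} (hc : HasSum x c) (hR : Summable (rProd R 0))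
    (hx : ∀ k, levelVec x (k + 1) = levelVec x k ᵥ* R k) :
    c = ∑ i, levelVec x 0 i + ∑ j, (levelVec x 0 ᵥ* rSeries R 0) j := by
  have sum_levels : HasSum (fun k => ∑ i, levelVec x k i) c := hc.sigma fun _ => hasSum_fintype _
  have hasSum_phase (j : Fin m) :
      HasSum (fun k => x ⟨k + 1, j⟩) ((levelVec x 0 ᵥ* rSeries R 0) j) := by
    refine (hasSum_vecMul_rSeries hR (levelVec x 0) j).congr_fun fun k => ?_
    rw [levelVec_zero_vecMul_rProd hx, levelVec]
  have sum_succ_levels : HasSum (fun k => ∑ j : Fin m, x ⟨k + 1, j⟩)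
      (∑ j, (levelVec x 0 ᵥ* rSeries R 0) j) := hasSum_sum fun j _ => hasSum_phase j
  exact sum_levels.unique (HasSum.zero_add (f := fun k => ∑ i, levelVec x k i) sum_succ_levels)

end RSequences

namespace LevelDependentQBD

variable {m₀ m : ℕ}

section Blocks

variable (A : LevelDependentQBD m₀ m)

theorem Q_same (k : ℕ) (i j : Fin (levelSize m₀ m k)) : A.Q ⟨k, i⟩ ⟨k, j⟩ = A.A1 k i j := by
  simp [Q]

theorem Q_up (k : ℕ) (i : Fin (levelSize m₀ m k)) (j : Fin (levelSize m₀ m (k + 1))) :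
    A.Q ⟨k, i⟩ ⟨k + 1, j⟩ = A.A0 k i j := by
  simp [Q]

theorem Q_down (k : ℕ) (i : Fin (levelSize m₀ m (k + 1))) (j : Fin (levelSize m₀ m k)) :
    A.Q ⟨k + 1, i⟩ ⟨k, j⟩ = A.A2 k i j := by
  simp [Q, show k ≠ k + 1 + 1 by omega]

theorem Q_eq_zero {s t : QBDState m₀ m} (h_same : t.1 ≠ s.1) (h_up : t.1 ≠ s.1 + 1)
    (h_down : s.1 ≠ t.1 + 1) : A.Q s t = 0 := by
  simp [Q, h_same, h_up, h_down]

theorem hasSum_mul_Q_zero (x : QBDState m₀ m → ℝ) (j : Fin (levelSize m₀ m 0)) :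
    HasSum (fun s => x s * A.Q s ⟨0, j⟩)
      ((levelVec x 0 ᵥ* A.A1 0 + levelVec x 1 ᵥ* A.A2 0) j) := by
  convert hasSum_sigma_of_fst_notMem {0, 1} (f := fun s => x s * A.Q s ⟨0, j⟩)
    (fun s hs => ?_) using 1
  · rw [Finset.sum_insert (by simp), Finset.sum_singleton]
    simp only [Q_same, Q_down]
    rfl
  · simp only [Finset.mem_insert, Finset.mem_singleton, not_or] at hs
    rw [A.Q_eq_zero (by dsimp only; omega) (by dsimp only; omega) (by dsimp only; omega),
      mul_zero]

theorem hasSum_mul_Q_succ (x : QBDState m₀ m → ℝ) (k : ℕ) (j : Fin (levelSize m₀ m (k + 1))) :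
    HasSum (fun s => x s * A.Q s ⟨k + 1, j⟩)
      ((levelVec x k ᵥ* A.A0 k + levelVec x (k + 1) ᵥ* A.A1 (k + 1) +
        levelVec x (k + 2) ᵥ* A.A2 (k + 1)) j) := by
  convert hasSum_sigma_of_fst_notMem {k, k + 1, k + 2} (f := fun s => x s * A.Q s ⟨k + 1, j⟩)
    (fun s hs => ?_) using 1
  · rw [Finset.sum_insert (by simp), Finset.sum_insert (by simp), Finset.sum_singleton, ← add_assoc]
    simp only [Q_same, Q_down, Q_up]
    rfl
  · simp only [Finset.mem_insert, Finset.mem_singleton, not_or] at hs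
    rw [A.Q_eq_zero (by dsimp only; omega) (by dsimp only; omega) (by dsimp only; omega),
      mul_zero]

theorem hasSum_mul_Q_zero_of_levelVec_one {R : RSequence m₀ m} {x : QBDState m₀ m → ℝ}
    (hx : levelVec x 1 = levelVec x 0 ᵥ* R 0) (j : Fin (levelSize m₀ m 0)) :
    HasSum (fun s => x s * A.Q s ⟨0, j⟩) ((levelVec x 0 ᵥ* A.U0 R) j) := by
  have hsum := A.hasSum_mul_Q_zero x j
  rwa [hx, Matrix.vecMul_vecMul, ← Matrix.vecMul_add] at hsum

theorem hasSum_mul_Q_succ_of_levelVec_succ {R : RSequence m₀ m} {x : QBDState m₀ m → ℝ} {k : ℕ}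
    (hx : levelVec x (k + 1) = levelVec x k ᵥ* R k)
    (hx' : levelVec x (k + 2) = levelVec x (k + 1) ᵥ* R (k + 1))
    (j : Fin (levelSize m₀ m (k + 1))) :
    HasSum (fun s => x s * A.Q s ⟨k + 1, j⟩)
      ((levelVec x k ᵥ* (A.A0 k + R k * A.A1 (k + 1) + R k * R (k + 1) * A.A2 (k + 1))) j) := by
  have hsum := A.hasSum_mul_Q_succ x k j
  rwa [hx', hx, Matrix.vecMul_vecMul, Matrix.vecMul_vecMul, Matrix.vecMul_vecMul,
    ← Matrix.mul_assoc, ← Matrix.vecMul_add, ← Matrix.vecMul_add] at hsum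

end Blocks

section RateMatrix

/-- The states of the levels up to `l`. The process can leave this set only from level `l`. -/
def levelsLE (m₀ m l : ℕ) : Set (QBDState m₀ m) := {s | s.1 ≤ l}

theorem mem_levelsLE {l : ℕ} {s : QBDState m₀ m} : s ∈ levelsLE m₀ m l ↔ s.1 ≤ l := Iff.rfl

theorem mk_mem_levelsLE {l : ℕ} (i : Fin (levelSize m₀ m l)) :
    (⟨l, i⟩ : QBDState m₀ m) ∈ levelsLE m₀ m l :=
  le_refl l

theorem levelsLE_mono {k l : ℕ} (hkl : k ≤ l) : levelsLE m₀ m k ⊆ levelsLE m₀ m l :=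
  fun _ hs => le_trans hs hkl

theorem setOf_fst_eq_zero : {s : QBDState m₀ m | s.1 = 0} = levelsLE m₀ m 0 :=
  Set.ext fun _ => Nat.le_zero.symm

/-- Neuts' rate matrices: the expected times spent in level `l + 1` before the next jump into the
levels up to `l`, per unit of time spent in level `l`. -/
noncomputable def rateMatrix (A : LevelDependentQBD m₀ m) : RSequence m₀ m := fun l i j =>
  (sojournTime A.Q (levelsLE m₀ m l) ⟨l, i⟩ ⟨l + 1, j⟩).toReal

variable {A : LevelDependentQBD m₀ m} {R : RSequence m₀ m}

theorem rateMatrix_nonneg (l : ℕ) (i : Fin (levelSize m₀ m l)) (j : Fin (levelSize m₀ m (l + 1))) :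
    0 ≤ A.rateMatrix l i j := ENNReal.toReal_nonneg

theorem sojournTime_levelsLE_eq_zero {l : ℕ} {s t : QBDState m₀ m} (hs : s.1 < l) (ht : l < t.1) :
    sojournTime A.Q (levelsLE m₀ m l) s t = 0 := by
  refine sojournTime_eq_zero (mem_levelsLE.2 hs.le) (fun a ha => ?_)
    (by rwa [mem_levelsLE, not_le])
  rw [mem_levelsLE, not_le] at ha
  exact A.Q_eq_zero (by omega) (by omega) (by omega)

theorem balayage_levelsLE (x : QBDState m₀ m → ℝ≥0∞) {l : ℕ} {t : QBDState m₀ m} (ht : l < t.1) :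
    balayage A.Q (levelsLE m₀ m l) x t =
      ∑ i, x ⟨l, i⟩ * sojournTime A.Q (levelsLE m₀ m l) ⟨l, i⟩ t := by
  classical
  rw [balayage, tsum_subtype _ fun s => x s * sojournTime A.Q (levelsLE m₀ m l) s t,
    (hasSum_sigma_of_fst_notMem {l} fun s hs => ?_).tsum_eq, Finset.sum_singleton]
  · exact Finset.sum_congr rfl fun i _ => Set.indicator_of_mem (mk_mem_levelsLE i) _
  · rw [Finset.mem_singleton] at hs
    refine Set.indicator_apply_eq_zero.2 fun hs_le => ?_
    rw [sojournTime_levelsLE_eq_zero (lt_of_le_of_ne hs_le hs) ht, mul_zero]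

theorem levelVec_succ_of_balayage_eq (h : IsIrreducibleRecurrent A.Q) {x : QBDState m₀ m → ℝ≥0∞}
    (hx_fin : ∀ s, x s ≠ ∞) {l : ℕ} (hx : balayage A.Q (levelsLE m₀ m l) x = x) :
    levelVec (fun s => (x s).toReal) (l + 1) =
      levelVec (fun s => (x s).toReal) l ᵥ* A.rateMatrix l := by
  funext j
  have x_eq := balayage_levelsLE (A := A) x (t := ⟨l + 1, j⟩) l.lt_succ_self
  rw [hx] at x_eq
  have term_ne_top (i : Fin (levelSize m₀ m l)) :
      x ⟨l, i⟩ * sojournTime A.Q (levelsLE m₀ m l) ⟨l, i⟩ ⟨l + 1, j⟩ ≠ ∞ :=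
    ENNReal.mul_ne_top (hx_fin _) (sojournTime_ne_top h.irreducible h.diag_neg
      (h.returnProb_eq_one _) (mk_mem_levelsLE i) _)
  rw [levelVec, x_eq, ENNReal.toReal_sum fun i _ => term_ne_top i]
  simp only [ENNReal.toReal_mul]
  rfl

theorem levelVec_succ_of_isInvariantVector (h : IsIrreducibleRecurrent A.Q) (hm₀ : 0 < m₀)
    {x : QBDState m₀ m → ℝ} (hx : IsInvariantVector A.Q x) (k : ℕ) :
    levelVec x (k + 1) = levelVec x k ᵥ* A.rateMatrix k := by
  have x_balayage := balayage_eq_self h.irreducible h.diag_neg (o := ⟨0, ⟨0, hm₀⟩⟩)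
    (mem_levelsLE.2 k.zero_le) (h.returnProb_eq_one _)
    (hx.inflow_eq_outflow h.isGenerator).le ENNReal.ofReal_ne_top
  simpa only [ENNReal.toReal_ofReal (hx.nonneg _)] using
    levelVec_succ_of_balayage_eq h (fun _ => ENNReal.ofReal_ne_top) x_balayage

theorem levelVec_sojournTime_self (hq : ∀ s, A.Q s s < 0) (l : ℕ) (i : Fin (levelSize m₀ m l)) :
    levelVec (fun s => (sojournTime A.Q (levelsLE m₀ m l) ⟨l, i⟩ s).toReal) l = Pi.single i 1 := by
  funext a
  obtain rfl | ha := eq_or_ne a i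
  · rw [levelVec, sojournTime_self hq (mk_mem_levelsLE a), Pi.single_eq_same, ENNReal.toReal_one]
  · rw [levelVec, sojournTime_of_mem_of_ne (mk_mem_levelsLE a) (by simpa using ha.symm),
      Pi.single_eq_of_ne ha, ENNReal.toReal_zero]

theorem levelVec_sojournTime_succ (h : IsIrreducibleRecurrent A.Q) {k l : ℕ} (hlk : l ≤ k)
    (i : Fin (levelSize m₀ m l)) :
    levelVec (fun s => (sojournTime A.Q (levelsLE m₀ m l) ⟨l, i⟩ s).toReal) (k + 1) =
      levelVec (fun s => (sojournTime A.Q (levelsLE m₀ m l) ⟨l, i⟩ s).toReal) k ᵥ*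
        A.rateMatrix k :=
  levelVec_succ_of_balayage_eq h
    (sojournTime_ne_top h.irreducible h.diag_neg (h.returnProb_eq_one _) (mk_mem_levelsLE i))
    (balayage_sojournTime h.diag_neg (levelsLE_mono hlk) (mk_mem_levelsLE i))

theorem isNonnegSolution_rateMatrix (h : IsIrreducibleRecurrent A.Q) :
    A.IsNonnegSolution A.rateMatrix := by
  refine ⟨rateMatrix_nonneg, fun l => ?_⟩
  ext i j
  have balance := hasSum_toReal_mul_generator_zero h.isGenerator h.diag_neg
    (sojournTime_ne_top h.irreducible h.diag_neg (h.returnProb_eq_one _) (mk_mem_levelsLE i) _)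
    (inflow_sojournTime_of_notMem (s := ⟨l + 1, j⟩) h.diag_neg (mk_mem_levelsLE i)
      (by simp [mem_levelsLE]))
  have equation := (A.hasSum_mul_Q_succ_of_levelVec_succ (levelVec_sojournTime_succ h le_rfl i)
    (levelVec_sojournTime_succ h l.le_succ i) j).unique balance
  rwa [levelVec_sojournTime_self h.diag_neg, Matrix.single_one_vecMul] at equation

theorem IsNonnegSolution.hasSum_mul_Q_succ_of_levelVec_succ (hR : A.IsNonnegSolution R)
    {x : QBDState m₀ m → ℝ} {k : ℕ} (hx : levelVec x (k + 1) = levelVec x k ᵥ* R k)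
    (hx' : levelVec x (k + 2) = levelVec x (k + 1) ᵥ* R (k + 1))
    (j : Fin (levelSize m₀ m (k + 1))) : HasSum (fun s => x s * A.Q s ⟨k + 1, j⟩) 0 := by
  simpa only [hR.2 k, Matrix.vecMul_zero, Pi.zero_apply] using
    A.hasSum_mul_Q_succ_of_levelVec_succ hx hx' j

theorem IsNonnegSolution.rateMatrix_le (hR : A.IsNonnegSolution R) (hgen : IsGenerator A.Q)
    (hq : ∀ s, A.Q s s < 0) (l : ℕ) (i : Fin (levelSize m₀ m l))
    (j : Fin (levelSize m₀ m (l + 1))) : A.rateMatrix l i j ≤ R l i j := by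
  set y := vecProd R l (Pi.single i 1)
  have y_nonneg (s : QBDState m₀ m) : 0 ≤ y s :=
    vecProd_nonneg hR.1 (Pi.single_nonneg.2 zero_le_one) s
  have y_start : y ⟨l, i⟩ = 1 := by
    change levelVec y l i = 1
    rw [levelVec_vecProd_self, Pi.single_eq_same]
  have y_next : y ⟨l + 1, j⟩ = R l i j := by
    change levelVec y (l + 1) j = _
    rw [levelVec_vecProd_of_le le_rfl, levelVec_vecProd_self, Matrix.single_one_vecMul]
    rfl
  have y_balance (s : QBDState m₀ m) (hs : s ∉ levelsLE m₀ m l) :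
      HasSum (fun t => y t * A.Q t s) 0 := by
    rw [mem_levelsLE, not_le] at hs
    obtain ⟨_ | k, a⟩ := s
    · exact absurd hs l.not_lt_zero
    · have hlk : l ≤ k := Nat.le_of_lt_succ hs
      exact hR.hasSum_mul_Q_succ_of_levelVec_succ (levelVec_vecProd_of_le hlk _)
        (levelVec_vecProd_of_le (hlk.trans k.le_succ) _) a
  have sojourn_le := mul_sojournTime_le hq (x := fun s => ENNReal.ofReal (y s))
    (fun s hs => (inflow_ofReal_eq_outflow hgen y_nonneg (y_balance s hs)).le)
    (mk_mem_levelsLE i) ⟨l + 1, j⟩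
  rw [y_start, y_next, ENNReal.ofReal_one, one_mul] at sojourn_le
  exact ENNReal.toReal_le_of_le_ofReal (hR.1 l i j) sojourn_le

theorem isMinimalNonnegSolution_rateMatrix (h : IsIrreducibleRecurrent A.Q) :
    A.IsMinimalNonnegSolution A.rateMatrix :=
  ⟨isNonnegSolution_rateMatrix h, fun _ hR => hR.rateMatrix_le h.isGenerator h.diag_neg⟩

theorem IsMinimalNonnegSolution.eq {R' : RSequence m₀ m} (hR : A.IsMinimalNonnegSolution R)
    (hR' : A.IsMinimalNonnegSolution R') : R = R' := by
  funext l
  ext i j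
  exact le_antisymm (hR.2 R' hR'.1 l i j) (hR'.2 R hR.1 l i j)

end RateMatrix

section Censored

variable {A : LevelDependentQBD m₀ m} {x : QBDState m₀ m → ℝ} {v : Fin (levelSize m₀ m 0) → ℝ}

theorem U0_rateMatrix_eq_censoredGenerator (h : IsIrreducibleRecurrent A.Q)
    (i j : Fin (levelSize m₀ m 0)) :
    A.U0 A.rateMatrix i j = censoredGenerator A.Q {s | s.1 = 0} ⟨0, i⟩ ⟨0, j⟩ := by
  have sum_eq_censored := hasSum_sojournTime_mul_generator h.isGenerator h.diag_neg
    (mk_mem_levelsLE i) (mk_mem_levelsLE j) (inflow_sojournTime_ne_top h.irreducible h.diag_neg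
      (h.returnProb_eq_one _) (mk_mem_levelsLE i) _)
  have sum_eq_U0 :=
    A.hasSum_mul_Q_zero_of_levelVec_one (levelVec_sojournTime_succ h le_rfl i) j
  rw [levelVec_sojournTime_self h.diag_neg, Matrix.single_one_vecMul] at sum_eq_U0
  rw [setOf_fst_eq_zero]
  exact sum_eq_U0.unique sum_eq_censored

theorem isInvariantVector_levelVec_zero (h : IsIrreducibleRecurrent A.Q) (hm₀ : 0 < m₀)
    (hx : IsInvariantVector A.Q x) : IsInvariantVector (A.U0 A.rateMatrix) (levelVec x 0) where
  nonneg i := hx.nonneg ⟨0, i⟩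
  hasSum_zero j := by
    rw [← (A.hasSum_mul_Q_zero_of_levelVec_one
      (levelVec_succ_of_isInvariantVector h hm₀ hx 0) j).unique (hx.hasSum_zero ⟨0, j⟩)]
    exact hasSum_fintype _

theorem isInvariantVector_vecProd {R : RSequence m₀ m} (hR : A.IsNonnegSolution R)
    (hv : IsInvariantVector (A.U0 R) v) : IsInvariantVector A.Q (vecProd R 0 v) where
  nonneg := vecProd_nonneg hR.1 hv.nonneg
  hasSum_zero := by
    have geometric (k : ℕ) := levelVec_vecProd_of_le (R := R) k.zero_le v
    rintro ⟨_ | k, j⟩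
    · have hsum := A.hasSum_mul_Q_zero_of_levelVec_one (geometric 0) j
      rw [levelVec_vecProd_self] at hsum
      convert hsum
      exact (hv.hasSum_zero j).unique (hasSum_fintype _)
    · exact hR.hasSum_mul_Q_succ_of_levelVec_succ (geometric k) (geometric (k + 1)) j

theorem summable_rProd_rateMatrix (h : IsIrreducibleRecurrent A.Q) (hm₀ : 0 < m₀)
    (hx : IsStationaryVector A.Q x) (k : ℕ) : Summable (rProd A.rateMatrix k) :=
  summable_rProd rateMatrix_nonneg
    (levelVec_succ_of_isInvariantVector h hm₀ hx.isInvariantVector)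
    (hx.pos h.isGenerator h.irreducible) hx.2.1.summable k

/-- The invariant extension of `v` is a multiple of `x`, and `κ` is the reciprocal of its total
mass. -/
theorem levelVec_zero_eq_kappa_smul (h : IsIrreducibleRecurrent A.Q) (hm₀ : 0 < m₀)
    (hx : IsStationaryVector A.Q x) (hv : IsStationaryVector (A.U0 A.rateMatrix) v) :
    levelVec x 0 = kappa A.rateMatrix v • v := by
  obtain ⟨c, hc⟩ : ∃ c, ∀ s, vecProd A.rateMatrix 0 v s = c * x s :=
    ⟨_, h.eq_div_mul_of_isInvariantVector hx.isInvariantVector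
      (isInvariantVector_vecProd (isNonnegSolution_rateMatrix h) hv.isInvariantVector)
      (o := ⟨0, ⟨0, hm₀⟩⟩) (hx.pos h.isGenerator h.irreducible _).ne'⟩
  have v_eq : v = c • levelVec x 0 := by
    rw [← levelVec_vecProd_self (R := A.rateMatrix) 0 v]
    exact funext fun i => hc ⟨0, i⟩
  have v_sum : ∑ i, v i = 1 := (hasSum_fintype v).unique hv.2.1
  have total_mass : HasSum (vecProd A.rateMatrix 0 v) c := by
    simpa only [mul_one] using (hx.2.1.mul_left c).congr_fun hc
  have c_eq := eq_add_sum_rSeries_of_hasSum total_mass (summable_rProd_rateMatrix h hm₀ hx 0)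
    fun k => levelVec_vecProd_of_le k.zero_le v
  rw [levelVec_vecProd_self, v_sum] at c_eq
  have c_ne_zero : c ≠ 0 := by
    rintro rfl
    simp [v_eq] at v_sum
  rw [kappa, ← c_eq, one_div, eq_inv_smul_iff₀ c_ne_zero, ← v_eq]

theorem existsUnique_isStationaryVector_U0 (h : IsIrreducibleRecurrent A.Q) (hm₀ : 0 < m₀)
    (hx : IsStationaryVector A.Q x) : ∃! v, IsStationaryVector (A.U0 A.rateMatrix) v := by
  have mass_pos : 0 < ∑ i, levelVec x 0 i :=
    Finset.sum_pos (fun i _ => hx.pos h.isGenerator h.irreducible _)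
      ⟨⟨0, hm₀⟩, Finset.mem_univ _⟩
  refine ⟨_, (isInvariantVector_levelVec_zero h hm₀ hx.isInvariantVector).isStationaryVector_div
    (hasSum_fintype _) mass_pos.ne', fun v hv => funext fun i => ?_⟩
  have x_eq := levelVec_zero_eq_kappa_smul h hm₀ hx hv
  have mass_eq : ∑ i, levelVec x 0 i = kappa A.rateMatrix v := by
    simp only [x_eq, Pi.smul_apply, smul_eq_mul, ← Finset.mul_sum]
    rw [(hasSum_fintype v).unique hv.2.1, mul_one]
  rw [eq_div_iff mass_pos.ne', mass_eq, x_eq, Pi.smul_apply, smul_eq_mul, mul_comm]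

end Censored

end LevelDependentQBD

theorem mainTheorem3 {m₀ m : ℕ} (hm₀ : 0 < m₀) (hm : 0 < m) (A : LevelDependentQBD m₀ m)
    (hgen : IsGenerator A.Q) (hirr : IsIrreducibleGenerator A.Q)
    (hrec : IsPositiveRecurrent A.Q) :
    (∃! x, IsStationaryVector A.Q x) ∧
    (∃! R, A.IsMinimalNonnegSolution R) ∧
    ∀ R, A.IsMinimalNonnegSolution R →
      (∀ i j, A.U0 R i j = censoredGenerator A.Q {s | s.1 = 0} ⟨0, i⟩ ⟨0, j⟩) ∧
      (∃! v, IsStationaryVector (A.U0 R) v) ∧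
      (∀ k, Summable (rProd R k)) ∧
      ∀ v x, IsStationaryVector (A.U0 R) v → IsStationaryVector A.Q x →
        (∀ i, x ⟨0, i⟩ = kappa R v * v i) ∧
        (∀ (k : ℕ) (j : Fin m), x ⟨k + 1, j⟩ = kappa R v * (v ᵥ* rProd R 0 k) j) ∧
        ∀ (k : ℕ) (j : Fin m),
          HasSum (fun n : ℕ => x ⟨k + n + 1, j⟩)
            (kappa R v *
              ((v ᵥ* rProd R 0 k) ᵥ* ((1 : Matrix (Fin m) (Fin m) ℝ) + rSeries R (k + 1))) j) := by
  have : Nontrivial (QBDState m₀ m) := ⟨⟨0, ⟨0, hm₀⟩⟩, ⟨1, ⟨0, hm⟩⟩, by simp⟩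
  have h := IsIrreducibleRecurrent.of_isPositiveRecurrent hgen hirr hrec
  obtain ⟨z, hz⟩ := h.exists_isStationaryVector (o := ⟨0, ⟨0, hm₀⟩⟩)
    ((hrec _).resolve_left (h.diag_neg _).ne).2
  have hmin := LevelDependentQBD.isMinimalNonnegSolution_rateMatrix h
  refine ⟨⟨z, hz, fun _ => h.isStationaryVector_unique hz⟩, ⟨_, hmin, fun R hR => hR.eq hmin⟩,
    fun R hR => ?_⟩
  obtain rfl := hR.eq hmin
  have hsummable := LevelDependentQBD.summable_rProd_rateMatrix h hm₀ hz
  refine ⟨LevelDependentQBD.U0_rateMatrix_eq_censoredGenerator h,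
    LevelDependentQBD.existsUnique_isStationaryVector_U0 h hm₀ hz, hsummable, fun v x hv hx => ?_⟩
  have hx_zero := LevelDependentQBD.levelVec_zero_eq_kappa_smul h hm₀ hx hv
  have hx_step := LevelDependentQBD.levelVec_succ_of_isInvariantVector h hm₀ hx.isInvariantVector
  have hx_succ (k : ℕ) : (levelVec x (k + 1) : Fin m → ℝ) =
      kappa A.rateMatrix v • (v ᵥ* rProd A.rateMatrix 0 k) := by
    rw [← levelVec_zero_vecMul_rProd hx_step, hx_zero, Matrix.smul_vecMul]
  refine ⟨congrFun hx_zero, fun k => congrFun (hx_succ k), fun k j => ?_⟩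
  simpa only [hx_succ, Matrix.smul_vecMul, Pi.smul_apply, smul_eq_mul] using
    hasSum_tail hx_step (hsummable (k + 1)) j
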